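/- Let $\mathcal X$ be a measurable space (for instance $\mathbb R^p$, or a measurable subset of it), let $P$ be a probability measure on $\mathcal X\times\mathbb R$, and let $(x_i,y_i)_{i\ge 1}$ be independent random pairs with common law $P$; put $D_n=\{(x_i,y_i)\}_{i=1}^n$. Let $K$ be a measurable positive definite kernel on $\mathcal X$ (symmetric, with nonnegative quadratic forms) and let $\mathbb H_K$ be its reproducing kernel Hilbert space. For $\omega\in(0,1)$ let $\phi_\omega(t)=(1-\omega)t^2$ for $t\le 0$ and $\phi_\omega(t)=\omega t^2$ for $t>0$. For $f\in\mathbb H_K$ and $\alpha_0\in\mathbb R$ define the risk $$\mathcal R(f,\alpha_0)=E_{(x,y)\sim P}\,\phi_\omega\big(y-\alpha_0-f(x)\big),$$ and the ideal risk $\mathcal R^*=\inf_{f\in\mathbb H_K,\ \alpha_0\in\mathbb R}\mathcal R(f,\alpha_0)$. For $n\ge 1$ and a penalty $\lambda=\lambda_n>0$, the kernel expectile regression estimator is $$(\hat f,\hat\alpha_0)=\operatorname*{arg\,min}_{f\in\mathbb H_K,\ \alpha_0\in\mathbb R}\ \sum_{i=1}^n\phi_\omega\big(y_i-\alpha_0-f(x_i)\big)+\lambda_n\|f\|_{\mathbb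 H_K}^2 ,$$ and its observed risk is $\mathcal R(\hat f,\hat\alpha_0)$, a random variable that depends on $D_n$. Assume that $M=\sup_x K(x,x)^{1/2}<\infty$, that $E y^2<\infty$, and that, as $n\to\infty$, $\lambda_n/n^{2/3}\to\infty$ and $\lambda_n/n\to 0$. Then all the risks $\mathcal R(f,\alpha_0)$ are finite, the minimizer $(\hat f,\hat\alpha_0)$ exists and is unique for every data set of size $n\ge1$ and every $\lambda_n>0$, the observed risk is integrable, the expected observed risk satisfies $$E_{D_n}\mathcal R(\hat f,\hat\alpha_0)\longrightarrow \mathcal R^*\qquad (n\to\infty),$$ and hence $\mathcal R(\hat f,\hat\alpha_0)-\mathcal R^*\to 0$ in probability. -/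

import Mathlib

open MeasureTheory ProbabilityTheory Filter Topology

namespace Expectile

/-- A (real) positive definite kernel on `X`: symmetric, with nonnegative quadratic forms. -/
structure PosDefKernel (X : Type*) where
  /-- The kernel function. -/
  toFun : X → X → ℝ
  symm : ∀ x y, toFun x y = toFun y x
  nonneg : ∀ (s : Finset X) (c : X → ℝ), 0 ≤ ∑ x ∈ s, ∑ y ∈ s, c x * c y * toFun x y

instance {X : Type*} : CoeFun (PosDefKernel X) (fun _ => X → X → ℝ) := ⟨PosDefKernel.toFun⟩

/-- The kernel, its real values being seen as operators `ℝ →L[ℝ] ℝ`, which is the form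
that Mathlib's construction of the reproducing kernel Hilbert space takes. -/
noncomputable def PosDefKernel.matrix {X : Type*} (K : PosDefKernel X) :
    Matrix X X (ℝ →L[ℝ] ℝ) :=
  Matrix.of fun x y => K x y • (1 : ℝ →L[ℝ] ℝ)

theorem PosDefKernel.posSemidef_matrix {X : Type*} (K : PosDefKernel X) :
    K.matrix.PosSemidef := by
  have key := (RKHS.posSemidef_tfae (K := K.matrix)).out 0 2
  refine key.2 ⟨?_, fun v => ?_⟩
  · ext x y
    simp [PosDefKernel.matrix, K.symm y x]
  · have h := K.nonneg v.support v
    simp only [PosDefKernel.matrix, Finsupp.sum]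
    refine le_of_le_of_eq h ?_
    simp only [RCLike.re_to_real]
    refine Finset.sum_congr rfl fun x _ => Finset.sum_congr rfl fun y _ => ?_
    simp [K.symm y x]
    ring

instance {X : Type*} (K : PosDefKernel X) : Fact K.matrix.PosSemidef := ⟨K.posSemidef_matrix⟩

/-- The reproducing kernel Hilbert space `H_K` of the kernel `K`; its elements are
functions on `X` through Mathlib's class `RKHS`. -/
abbrev PosDefKernel.Space {X : Type*} (K : PosDefKernel X) : Type _ := RKHS.OfKernel K.matrix

/-- The expectile (asymmetric squared) loss `φ_w`. -/
noncomputable def loss (w t : ℝ) : ℝ := if t ≤ 0 then (1 - w) * t ^ 2 else w * t ^ 2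

/-- The expectile risk `R(f, a) = E φ_w (y - a - f x)` when `(x, y)` has law `P`. -/
noncomputable def risk {X : Type*} [MeasurableSpace X] (w : ℝ) (P : Measure (X × ℝ))
    (f : X → ℝ) (a : ℝ) : ℝ :=
  ∫ z, loss w (z.2 - a - f z.1) ∂P

/-- The ideal risk: the infimum of `R(f, a)` over `f ∈ H_K` and `a ∈ ℝ`. -/
noncomputable def idealRisk {X : Type*} [MeasurableSpace X] (w : ℝ) (P : Measure (X × ℝ))
    (K : PosDefKernel X) : ℝ :=
  ⨅ q : K.Space × ℝ, risk w P q.1 q.2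

/-- The penalized empirical objective `∑ φ_w (y_i - a - f x_i) + l ‖f‖²` at `(f, a)`. -/
noncomputable def objective {X : Type*} (w : ℝ) (K : PosDefKernel X) (l : ℝ) {n : ℕ}
    (d : Fin n → X × ℝ) (q : K.Space × ℝ) : ℝ :=
  (∑ i, loss w ((d i).2 - q.2 - q.1 (d i).1)) + l * ‖q.1‖ ^ 2

/-- `q = (f, a)` minimizes the penalized empirical objective over `H_K × ℝ`. -/
def IsMinimizer {X : Type*} (w : ℝ) (K : PosDefKernel X) (l : ℝ) {n : ℕ}
    (d : Fin n → X × ℝ) (q : K.Space × ℝ) : Prop :=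
  ∀ q' : K.Space × ℝ, objective w K l d q ≤ objective w K l d q'

/-- The kernel expectile regression estimator trained on the data `d` with penalty `l`:
the minimizer of the penalized empirical objective. -/
noncomputable def estimator {X : Type*} (w : ℝ) (K : PosDefKernel X) (l : ℝ) {n : ℕ}
    (d : Fin n → X × ℝ) : K.Space × ℝ :=
  Classical.epsilon (IsMinimizer w K l d)

/-- The observed risk `R(f̂, â)` of the estimator trained on the data `d`. -/
noncomputable def observedRisk {X : Type*} [MeasurableSpace X] (w : ℝ) (P : Measure (X × ℝ))
    (K : PosDefKernel X) (l : ℝ) {n : ℕ} (d : Fin n → X × ℝ) : ℝ :=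
  risk w P (estimator w K l d).1 (estimator w K l d).2

end Expectile

/-!
By exchangeability, the expected risk of the estimator trained on `n` observations is the average,
over the `n + 1` observations of a larger sample, of the expected loss at an observation of the
estimator trained on the others. The penalized empirical loss is strongly convex and the square of a
prediction is at most `κ` times the modulus of convexity, with `κ → 0` because `λ → ∞`; hence
leaving out an observation multiplies the loss there by at most `(1 + κ) ^ 2`. The sum of the losses
of the full-sample estimator is at most the objective at any fixed `(f, a)`, whose expectation per
observation tends to the risk of `(f, a)` because `λ / n → 0`.

The observed risk is never below the ideal risk, so convergence of its expectation forces
convergence in probability. The estimator is measurable in the sample because it is the limit of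
gradient descent, every step of which depends measurably on the sample.
-/

namespace Expectile

open scoped RealInnerProductSpace

section Loss

variable {w : ℝ}

/-- The derivative of the expectile loss. -/
noncomputable def slope (w t : ℝ) : ℝ := if t ≤ 0 then 2 * (1 - w) * t else 2 * w * t

theorem loss_nonneg (hw0 : 0 < w) (hw1 : w < 1) (t : ℝ) : 0 ≤ loss w t := by
  unfold loss
  have := sub_pos.2 hw1
  split_ifs <;> positivity

theorem loss_le_sq (hw0 : 0 < w) (hw1 : w < 1) (t : ℝ) : loss w t ≤ t ^ 2 := by
  unfold loss
  split_ifs <;> nlinarith [sq_nonneg t]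

theorem slope_sq_le (hw0 : 0 < w) (hw1 : w < 1) (t : ℝ) : slope w t ^ 2 ≤ 4 * loss w t := by
  have hw := mul_nonneg (mul_nonneg hw0.le (sub_pos.2 hw1).le) (sq_nonneg t)
  unfold loss slope
  split_ifs <;> nlinarith

theorem abs_slope_sub_le (hw0 : 0 < w) (hw1 : w < 1) (s t : ℝ) :
    |slope w s - slope w t| ≤ 2 * |s - t| := by
  unfold slope
  rcases le_total s t with h | h
  · rw [abs_of_nonpos (sub_nonpos.2 h), abs_le]
    split_ifs <;> constructor <;> nlinarith
  · rw [abs_of_nonneg (sub_nonneg.2 h), abs_le]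
    split_ifs <;> constructor <;> nlinarith

theorem loss_add_le (hw0 : 0 < w) (hw1 : w < 1) (s u : ℝ) :
    loss w (s + u) ≤ loss w s + slope w s * u + u ^ 2 := by
  unfold loss slope
  split_ifs with h1 h2 h2
  · nlinarith [mul_nonneg hw0.le (sq_nonneg u)]
  · nlinarith [mul_nonneg hw0.le (sq_nonneg u), mul_nonneg hw0.le (sq_nonneg (s + u)),
      mul_nonneg (sub_pos.2 hw1).le (sq_nonneg s), mul_nonneg (sub_pos.2 hw1).le
      (mul_nonneg (not_le.1 h2).le (neg_nonneg.2 h1))]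
  · nlinarith [mul_nonneg hw0.le (mul_nonneg (not_le.1 h1).le (neg_nonneg.2 h2)),
      mul_nonneg hw0.le (sq_nonneg s)]
  · nlinarith [mul_nonneg (sub_pos.2 hw1).le (sq_nonneg u)]

theorem le_loss_add {c : ℝ} (hcw : c ≤ w) (hcw' : c ≤ 1 - w) (s u : ℝ) :
    loss w s + slope w s * u + c * u ^ 2 ≤ loss w (s + u) := by
  unfold loss slope
  split_ifs with h1 h2 h2
  · nlinarith [mul_nonneg (sub_nonneg.2 hcw') (sq_nonneg u)]
  · have h2 := not_le.1 h2
    nlinarith [mul_nonneg (sub_nonneg.2 hcw') (sq_nonneg s),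
      mul_nonneg (sub_nonneg.2 hcw') (mul_nonneg h2.le (neg_nonneg.2 h1)),
      mul_nonneg (sub_nonneg.2 hcw) (sq_nonneg (s + u))]
  · have h1 := not_le.1 h1
    nlinarith [mul_nonneg (sub_nonneg.2 hcw) (sq_nonneg s),
      mul_nonneg (sub_nonneg.2 hcw) (mul_nonneg h1.le (neg_nonneg.2 h2)),
      mul_nonneg (sub_nonneg.2 hcw') (sq_nonneg (s + u))]
  · nlinarith [mul_nonneg (sub_nonneg.2 hcw) (sq_nonneg u)]

theorem measurable_loss : Measurable (loss w) :=
  Measurable.ite measurableSet_Iic (by fun_prop) (by fun_prop)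

theorem measurable_slope : Measurable (slope w) :=
  Measurable.ite measurableSet_Iic (by fun_prop) (by fun_prop)

end Loss

section StronglyMonotone

variable {H : Type*} [NormedAddCommGroup H] [InnerProductSpace ℝ H] {A : H → H} {m L : ℝ}

theorem contractingWith_sub_smul (hm : 0 < m) (hL : 0 < L)
    (hmono : ∀ p q, m * ‖p - q‖ ^ 2 ≤ ⟪A p - A q, p - q⟫)
    (hlip : ∀ p q, ‖A p - A q‖ ≤ L * ‖p - q‖) :
    ContractingWith (√(1 - (m / L) ^ 2)).toNNReal fun q => q - (m / L ^ 2) • A q := by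
  refine ⟨?_, LipschitzWith.of_dist_le_mul fun p q => ?_⟩
  · rw [Real.toNNReal_lt_one, Real.sqrt_lt' one_pos]
    have : 0 < (m / L) ^ 2 := by positivity
    linarith
  · have hsq : ‖(p - q) - (m / L ^ 2) • (A p - A q)‖ ^ 2 ≤ (1 - (m / L) ^ 2) * ‖p - q‖ ^ 2 :=
      calc ‖(p - q) - (m / L ^ 2) • (A p - A q)‖ ^ 2
        _ = ‖p - q‖ ^ 2 - 2 * (m / L ^ 2) * ⟪A p - A q, p - q⟫
              + (m / L ^ 2) ^ 2 * ‖A p - A q‖ ^ 2 := by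
            rw [norm_sub_sq_real, real_inner_smul_right, real_inner_comm, norm_smul, mul_pow,
              Real.norm_eq_abs, sq_abs]
            ring
        _ ≤ ‖p - q‖ ^ 2 - 2 * (m / L ^ 2) * (m * ‖p - q‖ ^ 2)
              + (m / L ^ 2) ^ 2 * (L * ‖p - q‖) ^ 2 := by
            gcongr
            · exact hmono p q
            · exact hlip p q
        _ = (1 - (m / L) ^ 2) * ‖p - q‖ ^ 2 := by field_simp; ring
    rw [Real.coe_toNNReal _ (Real.sqrt_nonneg _), dist_eq_norm, dist_eq_norm, sub_sub_sub_comm,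
      ← smul_sub, ← Real.sqrt_sq (norm_nonneg (p - q)), ← Real.sqrt_mul' _ (sq_nonneg _)]
    exact Real.le_sqrt_of_sq_le hsq

end StronglyMonotone

section Regression

variable {E : Type*} [NormedAddCommGroup E]

/-- The input `x` with a constant coordinate appended, so that the prediction `⟪x, f⟫ + a` of the
parameter `q = (f, a)` at `x` becomes the inner product `⟪augment x, q⟫`. -/
def augment (x : E) : WithLp 2 (E × ℝ) := WithLp.toLp 2 (x, 1)

theorem norm_augment_sq (x : E) : ‖augment x‖ ^ 2 = ‖x‖ ^ 2 + 1 := by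
  simp [augment, WithLp.prod_norm_sq_eq_of_L2]

variable [InnerProductSpace ℝ E] {ι : Type*} [Fintype ι] {w l M : ℝ} {x : ι → E} {y : ι → ℝ}

theorem inner_augment (x : E) (q : WithLp 2 (E × ℝ)) : ⟪augment x, q⟫ = ⟪x, q.fst⟫ + q.snd := by
  simp [augment, WithLp.prod_inner_apply]

variable (w l x y) in
/-- The penalized empirical expectile loss of the parameter `q = (f, a)`; the intercept `a` is not
penalized. -/
noncomputable def penalizedLoss (q : WithLp 2 (E × ℝ)) : ℝ :=
  ∑ i, loss w (y i - ⟪augment (x i), q⟫) + l * ‖q.fst‖ ^ 2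

variable (w l x y) in
/-- The gradient of `penalizedLoss`. -/
noncomputable def penalizedLossGrad (q : WithLp 2 (E × ℝ)) : WithLp 2 (E × ℝ) :=
  (2 * l) • WithLp.toLp 2 (q.fst, 0) -
    ∑ i, slope w (y i - ⟪augment (x i), q⟫) • augment (x i)

variable (w l x y) in
/-- One step of gradient descent on `penalizedLoss`, with step size `η`. -/
noncomputable def gradientStep (η : ℝ) (q : WithLp 2 (E × ℝ)) : WithLp 2 (E × ℝ) :=
  q - η • penalizedLossGrad w l x y q

variable (w l x) in
/-- The modulus of strong convexity of `penalizedLoss`: a quadratic form that bounds its excess over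
each of its tangents from below. -/
noncomputable def curvature (v : WithLp 2 (E × ℝ)) : ℝ :=
  min w (1 - w) * ∑ i, ⟪augment (x i), v⟫ ^ 2 + l * ‖v.fst‖ ^ 2

theorem inner_penalizedLossGrad (q v : WithLp 2 (E × ℝ)) :
    ⟪penalizedLossGrad w l x y q, v⟫ =
      2 * l * ⟪q.fst, v.fst⟫ - ∑ i, slope w (y i - ⟪augment (x i), q⟫) * ⟪augment (x i), v⟫ := by
  simp only [penalizedLossGrad, inner_sub_left, sum_inner, real_inner_smul_left]
  simp [WithLp.prod_inner_apply]

theorem penalizedLossGrad_fst (q : WithLp 2 (E × ℝ)) :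
    (penalizedLossGrad w l x y q).fst =
      (2 * l) • q.fst - ∑ i, slope w (y i - ⟪augment (x i), q⟫) • x i := by
  rw [penalizedLossGrad, WithLp.sub_fst, WithLp.smul_fst, WithLp.toLp_fst]
  exact congrArg _ (map_sum (WithLp.fstₗ 2 ℝ E ℝ) _ _)

theorem penalizedLossGrad_snd (q : WithLp 2 (E × ℝ)) :
    (penalizedLossGrad w l x y q).snd = -∑ i, slope w (y i - ⟪augment (x i), q⟫) := by
  rw [penalizedLossGrad, WithLp.sub_snd, WithLp.smul_snd, WithLp.toLp_snd, smul_zero, zero_sub]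
  refine congrArg _ ((map_sum (WithLp.sndₗ 2 ℝ E ℝ) _ _).trans ?_)
  simp [augment]

theorem le_penalizedLoss_add (q v : WithLp 2 (E × ℝ)) :
    penalizedLoss w l x y q + ⟪penalizedLossGrad w l x y q, v⟫ + curvature w l x v ≤
      penalizedLoss w l x y (q + v) := by
  have hloss : ∀ i, loss w (y i - ⟪augment (x i), q⟫)
      - slope w (y i - ⟪augment (x i), q⟫) * ⟪augment (x i), v⟫
      + min w (1 - w) * ⟪augment (x i), v⟫ ^ 2 ≤ loss w (y i - ⟪augment (x i), q + v⟫) := by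
    intro i
    have h := le_loss_add (min_le_left w (1 - w)) (min_le_right w (1 - w))
      (y i - ⟪augment (x i), q⟫) (-⟪augment (x i), v⟫)
    rw [inner_add_right, ← sub_sub]
    simpa only [mul_neg, neg_sq, ← sub_eq_add_neg] using h
  have hsum := Finset.sum_le_sum fun i (_ : i ∈ Finset.univ) => hloss i
  rw [Finset.sum_add_distrib, Finset.sum_sub_distrib, ← Finset.mul_sum] at hsum
  rw [penalizedLoss, penalizedLoss, inner_penalizedLossGrad, curvature, WithLp.add_fst,
    norm_add_sq_real]
  linarith

theorem two_mul_curvature_sub_le_inner (p q : WithLp 2 (E × ℝ)) :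
    2 * curvature w l x (p - q) ≤
      ⟪penalizedLossGrad w l x y p - penalizedLossGrad w l x y q, p - q⟫ := by
  have hp := le_penalizedLoss_add (w := w) (l := l) (x := x) (y := y) p (q - p)
  have hq := le_penalizedLoss_add (w := w) (l := l) (x := x) (y := y) q (p - q)
  have hcurv : curvature w l x (q - p) = curvature w l x (p - q) := by
    simp only [← neg_sub p q, curvature, inner_neg_right, neg_sq, WithLp.neg_fst, norm_neg]
  rw [add_sub_cancel, hcurv, ← neg_sub p q, inner_neg_right] at hp
  rw [add_sub_cancel] at hq
  rw [inner_sub_left]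
  linarith

theorem penalizedLossGrad_sub (p q : WithLp 2 (E × ℝ)) :
    penalizedLossGrad w l x y p - penalizedLossGrad w l x y q =
      (2 * l) • WithLp.toLp 2 ((p - q).fst, 0) -
        ∑ i, (slope w (y i - ⟪augment (x i), p⟫) - slope w (y i - ⟪augment (x i), q⟫)) •
          augment (x i) := by
  have hfst : (WithLp.toLp 2 ((p - q).fst, 0) : WithLp 2 (E × ℝ)) =
      WithLp.toLp 2 (p.fst, 0) - WithLp.toLp 2 (q.fst, 0) := by
    rw [WithLp.sub_fst, ← WithLp.toLp_sub, Prod.mk_sub_mk, sub_zero]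
  simp only [penalizedLossGrad, sub_smul, Finset.sum_sub_distrib, hfst, smul_sub]
  abel

theorem norm_slope_sub_smul_augment_le (hw0 : 0 < w) (hw1 : w < 1) {z : E} (hz : ‖z‖ ≤ M) (t : ℝ)
    (p q : WithLp 2 (E × ℝ)) :
    ‖(slope w (t - ⟪augment z, p⟫) - slope w (t - ⟪augment z, q⟫)) • augment z‖ ≤
      2 * (M ^ 2 + 1) * ‖p - q‖ :=
  calc _ = |slope w (t - ⟪augment z, p⟫) - slope w (t - ⟪augment z, q⟫)| * ‖augment z‖ :=
        norm_smul _ _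
    _ ≤ 2 * |⟪augment z, p - q⟫| * ‖augment z‖ := by
        gcongr
        refine (abs_slope_sub_le hw0 hw1 _ _).trans_eq ?_
        rw [sub_sub_sub_cancel_left, ← inner_sub_right, ← abs_neg, ← inner_neg_right, neg_sub]
    _ ≤ 2 * (‖augment z‖ * ‖p - q‖) * ‖augment z‖ := by
        gcongr
        exact abs_real_inner_le_norm _ _
    _ = 2 * (‖z‖ ^ 2 + 1) * ‖p - q‖ := by rw [← norm_augment_sq]; ring
    _ ≤ 2 * (M ^ 2 + 1) * ‖p - q‖ := by gcongr

theorem norm_penalizedLossGrad_sub_le (hw0 : 0 < w) (hw1 : w < 1) (hl : 0 ≤ l)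
    (hM : ∀ i, ‖x i‖ ≤ M) (p q : WithLp 2 (E × ℝ)) :
    ‖penalizedLossGrad w l x y p - penalizedLossGrad w l x y q‖ ≤
      (2 * l + 2 * Fintype.card ι * (M ^ 2 + 1)) * ‖p - q‖ := by
  have hpen : ‖(WithLp.toLp 2 ((p - q).fst, 0) : WithLp 2 (E × ℝ))‖ ≤ ‖p - q‖ := by
    refine le_of_sq_le_sq ?_ (norm_nonneg _)
    rw [WithLp.prod_norm_sq_eq_of_L2, WithLp.prod_norm_sq_eq_of_L2 (p - q)]
    simpa using sq_nonneg (p - q).snd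
  rw [penalizedLossGrad_sub]
  refine (norm_sub_le _ _).trans ?_
  rw [norm_smul, Real.norm_of_nonneg (by positivity), add_mul]
  gcongr
  refine (norm_sum_le_of_le _ fun i _ =>
    norm_slope_sub_smul_augment_le hw0 hw1 (hM i) (y i) p q).trans_eq ?_
  rw [Finset.sum_const, Finset.card_univ, nsmul_eq_mul]
  ring

variable (w l M) in
/-- The constant of the leave-one-out stability of expectile regression on `n` inputs of norm at
most `M`: it bounds the squared prediction error by the curvature. -/
noncomputable def stabilityConst (n : ℕ) : ℝ := 2 / (min w (1 - w) * n) + 8 * M ^ 2 / l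

theorem stabilityConst_nonneg (hw0 : 0 < w) (hw1 : w < 1) (hl : 0 ≤ l) (n : ℕ) :
    0 ≤ stabilityConst w l M n := by
  have : 0 < min w (1 - w) := lt_min hw0 (sub_pos.2 hw1)
  unfold stabilityConst
  positivity

theorem inner_augment_sq_le_add {z x' : E} (hz : ‖z‖ ≤ M) (hx' : ‖x'‖ ≤ M)
    (v : WithLp 2 (E × ℝ)) :
    ⟪augment z, v⟫ ^ 2 ≤ 2 * ⟪augment x', v⟫ ^ 2 + 8 * M ^ 2 * ‖v.fst‖ ^ 2 := by
  have hdiff : |⟪z - x', v.fst⟫| ≤ 2 * M * ‖v.fst‖ :=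
    (abs_real_inner_le_norm _ _).trans <| by
      gcongr
      linarith [norm_sub_le z x']
  have hdiff_sq : ⟪z - x', v.fst⟫ ^ 2 ≤ (2 * M * ‖v.fst‖) ^ 2 :=
    sq_le_sq' (abs_le.1 hdiff).1 (abs_le.1 hdiff).2
  have hsplit : ⟪augment z, v⟫ = ⟪augment x', v⟫ + ⟪z - x', v.fst⟫ := by
    rw [inner_augment, inner_augment, inner_sub_left]
    ring
  rw [hsplit]
  linarith [add_sq_le (a := ⟪augment x', v⟫) (b := ⟪z - x', v.fst⟫)]

theorem inner_augment_sq_le [Nonempty ι] (hw0 : 0 < w) (hw1 : w < 1) (hl : 0 < l)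
    (hM : ∀ i, ‖x i‖ ≤ M) {z : E} (hz : ‖z‖ ≤ M) (v : WithLp 2 (E × ℝ)) :
    ⟪augment z, v⟫ ^ 2 ≤ stabilityConst w l M (Fintype.card ι) * curvature w l x v := by
  set c := min w (1 - w)
  set n : ℝ := (Fintype.card ι : ℝ)
  have hc0 : 0 < c := lt_min hw0 (sub_pos.2 hw1)
  have hn0 : 0 < n := Nat.cast_pos.2 Fintype.card_pos
  -- The prediction at `z` is compared with the average of the predictions at the `x i`.
  have hsum : n * ⟪augment z, v⟫ ^ 2 ≤
      2 * ∑ i, ⟪augment (x i), v⟫ ^ 2 + n * (8 * M ^ 2 * ‖v.fst‖ ^ 2) := by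
    simpa [Finset.sum_add_distrib, Finset.mul_sum, n] using
      Finset.sum_le_sum fun i (_ : i ∈ Finset.univ) => inner_augment_sq_le_add hz (hM i) v
  calc ⟪augment z, v⟫ ^ 2
    _ ≤ (2 * ∑ i, ⟪augment (x i), v⟫ ^ 2 + n * (8 * M ^ 2 * ‖v.fst‖ ^ 2)) / n :=
        (le_div_iff₀' hn0).2 hsum
    _ = 2 / (c * n) * (c * ∑ i, ⟪augment (x i), v⟫ ^ 2)
          + 8 * M ^ 2 / l * (l * ‖v.fst‖ ^ 2) := by field_simp
    _ ≤ 2 / (c * n) * curvature w l x v + 8 * M ^ 2 / l * curvature w l x v := by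
        gcongr
        · exact le_add_of_nonneg_right (by positivity)
        · exact le_add_of_nonneg_left (by positivity)
    _ = _ := (add_mul _ _ _).symm

theorem norm_sq_le_curvature [Nonempty ι] (hw0 : 0 < w) (hw1 : w < 1) (hl : 0 < l)
    (hM : ∀ i, ‖x i‖ ≤ M) (v : WithLp 2 (E × ℝ)) :
    ‖v‖ ^ 2 ≤ (1 / l + stabilityConst w l M (Fintype.card ι)) * curvature w l x v := by
  have hc0 : 0 ≤ min w (1 - w) := le_min hw0.le (sub_pos.2 hw1).le
  have hM0 : ‖(0 : E)‖ ≤ M :=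
    norm_zero.trans_le ((norm_nonneg _).trans (hM (Classical.arbitrary ι)))
  have hfst : ‖v.fst‖ ^ 2 ≤ 1 / l * curvature w l x v := by
    rw [one_div_mul_eq_div, le_div_iff₀' hl]
    exact le_add_of_nonneg_left
      (mul_nonneg hc0 (Finset.sum_nonneg fun _ _ => sq_nonneg _))
  have hsnd := inner_augment_sq_le hw0 hw1 hl hM hM0 v
  rw [inner_augment, inner_zero_left, zero_add] at hsnd
  rw [WithLp.prod_norm_sq_eq_of_L2, Real.norm_eq_abs, sq_abs, add_mul]
  exact add_le_add hfst hsnd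

theorem eq_of_curvature_sub_nonpos [Nonempty ι] (hw0 : 0 < w) (hw1 : w < 1) (hl : 0 < l)
    {p q : WithLp 2 (E × ℝ)} (h : curvature w l x (p - q) ≤ 0) : p = q := by
  obtain ⟨M, hM⟩ := Finite.exists_le fun i => ‖x i‖
  have hstab := stabilityConst_nonneg (M := M) hw0 hw1 hl.le (Fintype.card ι)
  refine sub_eq_zero.1 (norm_eq_zero.1 (pow_eq_zero_iff two_ne_zero |>.1 ?_))
  exact le_antisymm ((norm_sq_le_curvature hw0 hw1 hl hM _).trans
    (mul_nonpos_of_nonneg_of_nonpos (by positivity) h)) (sq_nonneg _)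

-- The step size depends on the data only through the bound on the inputs, so that it can be chosen
-- uniformly over all samples of a given size.
variable (E ι M) in
theorem exists_tendsto_iterate_gradientStep [CompleteSpace E] [Nonempty ι] (hw0 : 0 < w)
    (hw1 : w < 1) (hl : 0 < l) :
    ∃ η : ℝ, ∀ (x : ι → E) (y : ι → ℝ), (∀ i, ‖x i‖ ≤ M) →
      ∃ q, penalizedLossGrad w l x y q = 0 ∧
        ∀ p, Tendsto (fun k => (gradientStep w l x y η)^[k] p) atTop (𝓝 q) := by
  set m := 2 / (1 / l + stabilityConst w l M (Fintype.card ι)) with hm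
  set L := 2 * l + 2 * Fintype.card ι * (M ^ 2 + 1)
  have hden : 0 < 1 / l + stabilityConst w l M (Fintype.card ι) :=
    add_pos_of_pos_of_nonneg (one_div_pos.2 hl) (stabilityConst_nonneg hw0 hw1 hl.le _)
  have hm0 : 0 < m := by positivity
  have hL0 : 0 < L := by positivity
  refine ⟨m / L ^ 2, fun x y hM => ?_⟩
  have hmono : ∀ p q, m * ‖p - q‖ ^ 2 ≤
      ⟪penalizedLossGrad w l x y p - penalizedLossGrad w l x y q, p - q⟫ := fun p q => by
    refine le_trans ?_ (two_mul_curvature_sub_le_inner p q)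
    rw [hm, div_mul_eq_mul_div, div_le_iff₀' hden, mul_left_comm]
    exact mul_le_mul_of_nonneg_left (norm_sq_le_curvature hw0 hw1 hl hM _) zero_le_two
  have hcontr := contractingWith_sub_smul hm0 hL0 hmono
    (norm_penalizedLossGrad_sub_le hw0 hw1 hl.le hM)
  refine ⟨hcontr.fixedPoint, ?_, hcontr.tendsto_iterate_fixedPoint⟩
  have hfix := sub_eq_self.1 hcontr.fixedPoint_isFixedPt
  exact (smul_eq_zero.1 hfix).resolve_left (by positivity)

theorem penalizedLoss_add_curvature_le {q : WithLp 2 (E × ℝ)}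
    (hq : penalizedLossGrad w l x y q = 0) (p : WithLp 2 (E × ℝ)) :
    penalizedLoss w l x y q + curvature w l x (p - q) ≤ penalizedLoss w l x y p := by
  simpa [hq] using le_penalizedLoss_add (w := w) (l := l) (x := x) (y := y) q (p - q)

theorem curvature_nonneg (hw0 : 0 < w) (hw1 : w < 1) (hl : 0 ≤ l) (v : WithLp 2 (E × ℝ)) :
    0 ≤ curvature w l x v := by
  have : 0 < min w (1 - w) := lt_min hw0 (sub_pos.2 hw1)
  unfold curvature
  positivity

theorem existsUnique_penalizedLossGrad_eq_zero [CompleteSpace E] [Nonempty ι] (hw0 : 0 < w)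
    (hw1 : w < 1) (hl : 0 < l) : ∃! q, penalizedLossGrad w l x y q = 0 := by
  obtain ⟨M, hM⟩ := Finite.exists_le fun i => ‖x i‖
  obtain ⟨η, hη⟩ := exists_tendsto_iterate_gradientStep E ι M hw0 hw1 hl
  obtain ⟨q, hq, -⟩ := hη x y hM
  refine ⟨q, hq, fun p hp => eq_of_curvature_sub_nonpos (x := x) hw0 hw1 hl ?_⟩
  have h := two_mul_curvature_sub_le_inner (w := w) (l := l) (x := x) (y := y) p q
  rw [hp, hq, sub_zero, inner_zero_left] at h
  linarith

theorem forall_penalizedLoss_le_iff [CompleteSpace E] [Nonempty ι] (hw0 : 0 < w) (hw1 : w < 1)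
    (hl : 0 < l) {q : WithLp 2 (E × ℝ)} :
    (∀ p, penalizedLoss w l x y q ≤ penalizedLoss w l x y p) ↔
      penalizedLossGrad w l x y q = 0 := by
  refine ⟨fun hmin => ?_, fun hq p => ?_⟩
  · obtain ⟨p, hp, -⟩ := existsUnique_penalizedLossGrad_eq_zero (x := x) (y := y) hw0 hw1 hl
    have hcurv : curvature w l x (q - p) ≤ 0 := by
      linarith [penalizedLoss_add_curvature_le hp q, hmin p]
    rwa [eq_of_curvature_sub_nonpos hw0 hw1 hl hcurv]
  · linarith [penalizedLoss_add_curvature_le hq p, curvature_nonneg (x := x) hw0 hw1 hl.le (p - q)]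

theorem penalizedLossGrad_removeNth {n : ℕ} (x : Fin (n + 1) → E) (y : Fin (n + 1) → ℝ)
    (i : Fin (n + 1)) (q : WithLp 2 (E × ℝ)) :
    penalizedLossGrad w l (i.removeNth x) (i.removeNth y) q =
      penalizedLossGrad w l x y q + slope w (y i - ⟪augment (x i), q⟫) • augment (x i) := by
  simp only [penalizedLossGrad, Fin.sum_univ_succAbove _ i, Fin.removeNth]
  abel

theorem loss_sub_le_of_abs_le {κ r t : ℝ} (hw0 : 0 < w) (hw1 : w < 1) (hκ : 0 ≤ κ)
    (ht : 2 * |t| ≤ κ * |slope w r|) : loss w (r - t) ≤ (1 + κ) ^ 2 * loss w r := by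
  have hslope : |slope w r| ^ 2 ≤ 4 * loss w r := (sq_abs _).trans_le (slope_sq_le hw0 hw1 r)
  have hcross : slope w r * -t ≤ |slope w r| * |t| :=
    (le_abs_self _).trans_eq (by rw [abs_mul, abs_neg])
  calc loss w (r - t)
    _ ≤ loss w r + slope w r * -t + (-t) ^ 2 := loss_add_le hw0 hw1 r (-t)
    _ ≤ loss w r + |slope w r| * |t| + |t| ^ 2 := by
        linarith [hcross, sq_abs t]
    _ ≤ loss w r + |slope w r| * (κ * |slope w r| / 2) + (κ * |slope w r| / 2) ^ 2 := by
        gcongr <;> linarith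
    _ = loss w r + (κ / 2 + κ ^ 2 / 4) * |slope w r| ^ 2 := by ring
    _ ≤ loss w r + (κ / 2 + κ ^ 2 / 4) * (4 * loss w r) := by gcongr
    _ = (1 + κ) ^ 2 * loss w r := by ring

theorem loss_leaveOneOut_le [Nonempty ι] (hw0 : 0 < w) (hw1 : w < 1) (hl : 0 < l)
    (hM : ∀ i, ‖x i‖ ≤ M) {z : E} (hz : ‖z‖ ≤ M) {t : ℝ} {q q' : WithLp 2 (E × ℝ)}
    (hq : penalizedLossGrad w l x y q = 0)
    (hq' : penalizedLossGrad w l x y q' = slope w (t - ⟪augment z, q'⟫) • augment z) :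
    loss w (t - ⟪augment z, q⟫) ≤
      (1 + stabilityConst w l M (Fintype.card ι)) ^ 2 * loss w (t - ⟪augment z, q'⟫) := by
  set κ := stabilityConst w l M (Fintype.card ι)
  set σ := slope w (t - ⟪augment z, q'⟫)
  set δ := ⟪augment z, q - q'⟫
  have hκ : 0 ≤ κ := stabilityConst_nonneg hw0 hw1 hl.le _
  have hcurv : 2 * curvature w l x (q - q') ≤ |σ| * |δ| := by
    refine (two_mul_curvature_sub_le_inner (y := y) q q').trans ?_
    rw [hq, hq', zero_sub, inner_neg_left, real_inner_smul_left, ← abs_mul]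
    exact neg_le_abs _
  have hδ : 2 * |δ| ≤ κ * |σ| := by
    have hsq : |δ| * (2 * |δ|) ≤ |δ| * (κ * |σ|) :=
      calc |δ| * (2 * |δ|) = 2 * δ ^ 2 := by rw [← sq_abs δ]; ring
        _ ≤ 2 * (κ * curvature w l x (q - q')) := by
            gcongr
            exact inner_augment_sq_le hw0 hw1 hl hM hz _
        _ = κ * (2 * curvature w l x (q - q')) := by ring
        _ ≤ κ * (|σ| * |δ|) := by gcongr
        _ = |δ| * (κ * |σ|) := by ring
    rcases (abs_nonneg δ).eq_or_lt with h | h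
    · rw [← h, mul_zero]
      positivity
    · exact le_of_mul_le_mul_left hsq h
  have hsplit : t - ⟪augment z, q⟫ = t - ⟪augment z, q'⟫ - δ := by
    rw [show δ = ⟪augment z, q⟫ - ⟪augment z, q'⟫ from inner_sub_right _ _ _]
    ring
  rw [hsplit]
  exact loss_sub_le_of_abs_le hw0 hw1 hκ hδ

end Regression

section Estimator

variable {X : Type*} (K : PosDefKernel X)

/-- The kernel section at `x`, as an element of the reproducing kernel Hilbert space. -/
noncomputable def PosDefKernel.feature (x : X) : K.Space := RKHS.kerFun K.Space x 1

variable {K}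

theorem inner_feature (f : K.Space) (x : X) : ⟪K.feature x, f⟫ = f x := by
  simp [PosDefKernel.feature]

theorem feature_apply (x y : X) : K.feature y x = K x y := by
  rw [PosDefKernel.feature, RKHS.kerFun_apply, RKHS.OfKernel.kernel_ofKernel]
  simp [PosDefKernel.matrix]

theorem norm_feature (x : X) : ‖K.feature x‖ = K x x ^ (1 / 2 : ℝ) := by
  rw [← Real.sqrt_eq_rpow, ← Real.sqrt_sq (norm_nonneg _), ← real_inner_self_eq_norm_sq,
    inner_feature, feature_apply]

theorem abs_apply_le {M : ℝ} (hM : ∀ x, ‖K.feature x‖ ≤ M) (f : K.Space) (x : X) :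
    |f x| ≤ M * ‖f‖ := by
  rw [← inner_feature]
  exact (abs_real_inner_le_norm _ _).trans (mul_le_mul_of_nonneg_right (hM x) (norm_nonneg _))

/-- The loss of `q = (f, a)` at the observation `z = (x, y)`. -/
noncomputable def pointLoss (w : ℝ) (q : K.Space × ℝ) (z : X × ℝ) : ℝ :=
  loss w (z.2 - q.2 - q.1 z.1)

theorem pointLoss_eq (w : ℝ) (q : K.Space × ℝ) (z : X × ℝ) :
    pointLoss w q z = loss w (z.2 - ⟪augment (K.feature z.1), WithLp.toLp 2 q⟫) := by
  rw [pointLoss, inner_augment, inner_feature, WithLp.toLp_fst, WithLp.toLp_snd, sub_sub, add_comm]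

variable {w l M : ℝ} {n : ℕ}

theorem pointLoss_nonneg (hw0 : 0 < w) (hw1 : w < 1) (q : K.Space × ℝ) (z : X × ℝ) :
    0 ≤ pointLoss w q z :=
  loss_nonneg hw0 hw1 _

theorem objective_eq (d : Fin n → X × ℝ) (q : K.Space × ℝ) :
    objective w K l d q = penalizedLoss w l (fun i => K.feature (d i).1) (fun i => (d i).2)
      (WithLp.toLp 2 q) := by
  simp only [penalizedLoss, ← pointLoss_eq w q (d _)]
  rfl

theorem gradientStep_fst_apply (η : ℝ) (d : Fin n → X × ℝ) (q : WithLp 2 (K.Space × ℝ)) (x : X) :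
    (gradientStep w l (fun i => K.feature (d i).1) (fun i => (d i).2) η q).fst x =
      q.fst x - η * (2 * l * q.fst x -
        ∑ i, slope w ((d i).2 - (q.fst (d i).1 + q.snd)) * K x (d i).1) := by
  simp only [gradientStep, ← inner_feature _ x, WithLp.sub_fst, WithLp.smul_fst,
    penalizedLossGrad_fst, inner_sub_right, inner_sum, real_inner_smul_right, inner_augment]
  simp only [inner_feature, feature_apply]

theorem gradientStep_snd (η : ℝ) (d : Fin n → X × ℝ) (q : WithLp 2 (K.Space × ℝ)) :
    (gradientStep w l (fun i => K.feature (d i).1) (fun i => (d i).2) η q).snd =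
      q.snd + η * ∑ i, slope w ((d i).2 - (q.fst (d i).1 + q.snd)) := by
  simp only [gradientStep, WithLp.sub_snd, WithLp.smul_snd, penalizedLossGrad_snd, inner_augment,
    inner_feature, smul_eq_mul, mul_neg, sub_neg_eq_add]

theorem pointLoss_le_objective (hw0 : 0 < w) (hw1 : w < 1) (hl : 0 ≤ l) (d : Fin n → X × ℝ)
    (q : K.Space × ℝ) (i : Fin n) : pointLoss w q (d i) ≤ objective w K l d q :=
  (Finset.single_le_sum (f := fun i => pointLoss w q (d i))
    (fun _ _ => pointLoss_nonneg hw0 hw1 _ _) (Finset.mem_univ i)).trans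
    (le_add_of_nonneg_right (by positivity))

variable [NeZero n]

theorem isMinimizer_iff (hw0 : 0 < w) (hw1 : w < 1) (hl : 0 < l) (d : Fin n → X × ℝ)
    (q : K.Space × ℝ) :
    IsMinimizer w K l d q ↔ penalizedLossGrad w l (fun i => K.feature (d i).1) (fun i => (d i).2)
      (WithLp.toLp 2 q) = 0 := by
  rw [← forall_penalizedLoss_le_iff hw0 hw1 hl, IsMinimizer]
  simp only [objective_eq]
  exact ⟨fun h p => h p.ofLp, fun h p => h (WithLp.toLp 2 p)⟩

theorem existsUnique_isMinimizer (hw0 : 0 < w) (hw1 : w < 1) (hl : 0 < l) (d : Fin n → X × ℝ) :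
    ∃! q : K.Space × ℝ, IsMinimizer w K l d q := by
  obtain ⟨q, hq, huniq⟩ := existsUnique_penalizedLossGrad_eq_zero
    (x := fun i => K.feature (d i).1) (y := fun i => (d i).2) hw0 hw1 hl
  refine ⟨q.ofLp, (isMinimizer_iff hw0 hw1 hl d _).2 hq, fun p hp => ?_⟩
  rw [← huniq _ ((isMinimizer_iff hw0 hw1 hl d p).1 hp)]

theorem isMinimizer_estimator (hw0 : 0 < w) (hw1 : w < 1) (hl : 0 < l) (d : Fin n → X × ℝ) :
    IsMinimizer w K l d (estimator w K l d) :=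
  Classical.epsilon_spec (existsUnique_isMinimizer hw0 hw1 hl d).exists

theorem pointLoss_estimator_removeNth_le (hw0 : 0 < w) (hw1 : w < 1) (hl : 0 < l)
    (hM : ∀ x, ‖K.feature x‖ ≤ M) (d : Fin (n + 1) → X × ℝ) (i : Fin (n + 1)) :
    pointLoss w (estimator w K l (i.removeNth d)) (d i) ≤
      (1 + stabilityConst w l M n) ^ 2 * pointLoss w (estimator w K l d) (d i) := by
  have hremoved := (isMinimizer_iff hw0 hw1 hl _ _).1
    (isMinimizer_estimator (K := K) hw0 hw1 hl (i.removeNth d))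
  have hfull := (isMinimizer_iff hw0 hw1 hl _ _).1 (isMinimizer_estimator (K := K) hw0 hw1 hl d)
  have hgrad := penalizedLossGrad_removeNth (w := w) (l := l) (fun i => K.feature (d i).1)
    (fun i => (d i).2) i (WithLp.toLp 2 (estimator w K l d))
  rw [hfull, zero_add] at hgrad
  rw [pointLoss_eq, pointLoss_eq]
  simpa only [Fintype.card_fin] using
    loss_leaveOneOut_le hw0 hw1 hl (fun _ => hM _) (hM _) hremoved hgrad

theorem sum_pointLoss_estimator_removeNth_le (hw0 : 0 < w) (hw1 : w < 1) (hl : 0 < l)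
    (hM : ∀ x, ‖K.feature x‖ ≤ M) (d : Fin (n + 1) → X × ℝ) (q : K.Space × ℝ) :
    ∑ i, pointLoss w (estimator w K l (i.removeNth d)) (d i) ≤
      (1 + stabilityConst w l M n) ^ 2 * objective w K l d q :=
  calc ∑ i, pointLoss w (estimator w K l (i.removeNth d)) (d i)
    _ ≤ (1 + stabilityConst w l M n) ^ 2 * ∑ i, pointLoss w (estimator w K l d) (d i) := by
        rw [Finset.mul_sum]
        exact Finset.sum_le_sum fun i _ => pointLoss_estimator_removeNth_le hw0 hw1 hl hM d i
    _ ≤ (1 + stabilityConst w l M n) ^ 2 * objective w K l d (estimator w K l d) := by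
        gcongr
        exact le_add_of_nonneg_right (by positivity)
    _ ≤ (1 + stabilityConst w l M n) ^ 2 * objective w K l d q := by
        gcongr
        exact isMinimizer_estimator hw0 hw1 hl d q

end Estimator

section Measurability

variable {X : Type*} [MeasurableSpace X] {K : PosDefKernel X} {D : Type*} [MeasurableSpace D]
  {F : D → WithLp 2 (K.Space × ℝ)} {w l M : ℝ} {n : ℕ}

theorem measurable_coe (hK : Measurable fun z : X × X => K z.1 z.2) (f : K.Space) :
    Measurable f := by
  let S : Submodule ℝ K.Space :=
    { carrier := {f | Measurable f}
      add_mem' := fun {f g} hf hg => by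
        simpa using Measurable.add (f := f) (g := g) hf hg
      zero_mem' := by simp only [Set.mem_ofPred_eq, RKHS.coe_zero]; exact measurable_zero
      smul_mem' := fun r f hf => by
        simp only [Set.mem_ofPred_eq, RKHS.coe_smul] at hf ⊢
        exact hf.const_smul r }
  have hclosed : IsClosed (S : Set K.Space) := by
    refine IsSeqClosed.isClosed fun u g hu hg => ?_
    refine measurable_of_tendsto_metrizable hu (tendsto_pi_nhds.2 fun x => ?_)
    exact ((RKHS.continuous_eval x).tendsto g).comp hg
  have htop : (⊤ : Submodule ℝ K.Space) ≤ S := by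
    rw [← RKHS.kerFun_dense K.Space]
    refine Submodule.topologicalClosure_minimal _ (Submodule.span_le.2 ?_) hclosed
    rintro _ ⟨y, v, rfl⟩
    have hsection : (fun x => RKHS.kerFun K.Space y v x) = fun x => K x y * v := by
      ext x
      rw [RKHS.kerFun_apply, RKHS.OfKernel.kernel_ofKernel]
      simp [PosDefKernel.matrix]
    change Measurable fun x => RKHS.kerFun K.Space y v x
    rw [hsection]
    exact (hK.comp measurable_prodMk_right).mul_const v
  exact htop (Submodule.mem_top (x := f))

/-- A family `F` of parameters `(f, a)` is jointly measurable if both `(d, x) ↦ (F d).fst x` and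
`d ↦ (F d).snd` are measurable. No measurable structure on the Hilbert space itself, which need not
be separable, is involved. -/
structure JointlyMeasurable (F : D → WithLp 2 (K.Space × ℝ)) : Prop where
  fst : Measurable fun p : D × X => (F p.1).fst p.2
  snd : Measurable fun d => (F d).snd

namespace JointlyMeasurable

theorem pointLoss (hF : JointlyMeasurable F) :
    Measurable fun p : (X × ℝ) × D => pointLoss w (F p.2).ofLp p.1 := by
  have hfst : Measurable fun p : (X × ℝ) × D => (F p.2).fst p.1.1 :=
    hF.fst.comp (f := fun p : (X × ℝ) × D => (p.2, p.1.1)) (by fun_prop)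
  have hsnd := hF.snd
  exact measurable_loss.comp ((measurable_fst.snd.sub (hsnd.comp measurable_snd)).sub hfst)

theorem of_tendsto {G : ℕ → D → WithLp 2 (K.Space × ℝ)} (hG : ∀ k, JointlyMeasurable (G k))
    (h : ∀ d, Tendsto (fun k => G k d) atTop (𝓝 (F d))) : JointlyMeasurable F := by
  have hofLp : ∀ d, Tendsto (fun k => (G k d).ofLp) atTop (𝓝 (F d).ofLp) := fun d =>
    ((WithLp.prod_continuous_ofLp 2 K.Space ℝ).tendsto _).comp (h d)
  constructor
  · refine measurable_of_tendsto_metrizable (fun k => (hG k).fst) (tendsto_pi_nhds.2 fun p => ?_)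
    exact ((RKHS.continuous_eval p.2).tendsto _).comp
      ((continuous_fst.tendsto _).comp (hofLp p.1))
  · exact measurable_of_tendsto_metrizable (fun k => (hG k).snd)
      (tendsto_pi_nhds.2 fun d => (continuous_snd.tendsto _).comp (hofLp d))

theorem gradientStep (hK : Measurable fun z : X × X => K z.1 z.2) (η : ℝ)
    {F : (Fin n → X × ℝ) → WithLp 2 (K.Space × ℝ)} (hF : JointlyMeasurable F) :
    JointlyMeasurable fun d =>
      gradientStep w l (fun i => K.feature (d i).1) (fun i => (d i).2) η (F d) := by
  have hslope : ∀ i, Measurable fun d : Fin n → X × ℝ =>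
      slope w ((d i).2 - ((F d).fst (d i).1 + (F d).snd)) := fun i => by
    have hfst : Measurable fun d : Fin n → X × ℝ => (F d).fst (d i).1 :=
      hF.fst.comp (f := fun d : Fin n → X × ℝ => (d, (d i).1)) (by fun_prop)
    exact measurable_slope.comp ((measurable_pi_apply i).snd.sub (hfst.add hF.snd))
  have hkernel : ∀ i, Measurable fun p : (Fin n → X × ℝ) × X => K p.2 (p.1 i).1 := fun i =>
    hK.comp (f := fun p : (Fin n → X × ℝ) × X => (p.2, (p.1 i).1)) (by fun_prop)
  constructor
  · simp only [gradientStep_fst_apply]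
    exact hF.fst.sub (((hF.fst.const_mul _).sub (Finset.measurable_fun_sum _ fun i _ =>
      ((hslope i).comp measurable_fst).mul (hkernel i))).const_mul η)
  · simp only [gradientStep_snd]
    exact hF.snd.add ((Finset.measurable_fun_sum _ fun i _ => hslope i).const_mul η)

theorem estimator [NeZero n] (hw0 : 0 < w) (hw1 : w < 1) (hl : 0 < l)
    (hM : ∀ x, ‖K.feature x‖ ≤ M) (hK : Measurable fun z : X × X => K z.1 z.2) :
    JointlyMeasurable fun d : Fin n → X × ℝ => WithLp.toLp 2 (estimator w K l d) := by
  obtain ⟨η, hη⟩ := exists_tendsto_iterate_gradientStep K.Space (Fin n) M hw0 hw1 hl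
  have hlim : ∀ d : Fin n → X × ℝ, Tendsto (fun k => (Expectile.gradientStep w l
      (fun i => K.feature (d i).1) (fun i => (d i).2) η)^[k] 0) atTop
      (𝓝 (WithLp.toLp 2 (Expectile.estimator w K l d))) := fun d => by
    obtain ⟨q, hq, hq_lim⟩ := hη (fun i => K.feature (d i).1) (fun i => (d i).2) fun _ => hM _
    have hest := (isMinimizer_iff hw0 hw1 hl d _).1 (isMinimizer_estimator (K := K) hw0 hw1 hl d)
    rw [(existsUnique_penalizedLossGrad_eq_zero hw0 hw1 hl).unique hest hq]
    exact hq_lim 0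
  refine of_tendsto (fun k => ?_) hlim
  induction k with
  | zero =>
    refine ⟨?_, measurable_const⟩
    simp only [Function.iterate_zero, id_eq, WithLp.zero_fst, RKHS.coe_zero]
    exact measurable_const
  | succ k ih =>
    simp only [Function.iterate_succ_apply']
    exact ih.gradientStep hK η

end JointlyMeasurable

end Measurability

section LeaveOneOut

variable {X : Type*} [MeasurableSpace X] {K : PosDefKernel X} {w l M : ℝ} {n : ℕ}
  {P : Measure (X × ℝ)}

theorem integrable_pointLoss [IsFiniteMeasure P] (hw0 : 0 < w) (hw1 : w < 1)
    (hM : ∀ x, ‖K.feature x‖ ≤ M) (hK : Measurable fun z : X × X => K z.1 z.2)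
    (hy : Integrable (fun z : X × ℝ => z.2 ^ 2) P) (q : K.Space × ℝ) :
    Integrable (pointLoss w q) P := by
  have hmeas : Measurable fun z : X × ℝ => q.1 z.1 := (measurable_coe hK q.1).comp measurable_fst
  have hy_memLp : MemLp (fun z : X × ℝ => z.2) 2 P :=
    (memLp_two_iff_integrable_sq measurable_snd.aestronglyMeasurable).2 hy
  have hf_memLp : MemLp (fun z : X × ℝ => q.1 z.1) 2 P :=
    MemLp.of_bound hmeas.aestronglyMeasurable (M * ‖q.1‖)
      (ae_of_all _ fun z => abs_apply_le hM q.1 z.1)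
  refine ((hy_memLp.sub (memLp_const q.2)).sub hf_memLp).integrable_sq.mono'
    (measurable_loss.comp ((measurable_snd.sub_const _).sub hmeas)).aestronglyMeasurable
    (ae_of_all _ fun z => ?_)
  rw [Real.norm_of_nonneg (pointLoss_nonneg hw0 hw1 q z)]
  exact loss_le_sq hw0 hw1 _

variable [IsProbabilityMeasure P]

theorem integrable_objective {q : K.Space × ℝ} (hq : Integrable (pointLoss w q) P) :
    Integrable (fun d : Fin n → X × ℝ => objective w K l d q) (Measure.pi fun _ => P) := by
  have hterm : ∀ i : Fin n, Integrable (fun d : Fin n → X × ℝ => pointLoss w q (d i))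
      (Measure.pi fun _ => P) := fun _ => integrable_comp_eval hq
  exact (integrable_finsetSum _ fun i _ => hterm i).add (integrable_const _)

theorem integral_objective {q : K.Space × ℝ} (hq : Integrable (pointLoss w q) P) :
    ∫ d : Fin n → X × ℝ, objective w K l d q ∂(Measure.pi fun _ => P) =
      n * risk w P q.1 q.2 + l * ‖q.1‖ ^ 2 := by
  have hint : ∀ i : Fin n, Integrable (fun d : Fin n → X × ℝ => pointLoss w q (d i))
      (Measure.pi fun _ => P) := fun _ => integrable_comp_eval hq
  have hterm : ∀ i : Fin n, ∫ d : Fin n → X × ℝ, pointLoss w q (d i) ∂(Measure.pi fun _ => P) =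
      risk w P q.1 q.2 := fun i =>
    integral_comp_eval hq.aestronglyMeasurable
  calc ∫ d : Fin n → X × ℝ, objective w K l d q ∂(Measure.pi fun _ => P)
    _ = ∫ d : Fin n → X × ℝ, ∑ i, pointLoss w q (d i) ∂(Measure.pi fun _ => P)
          + ∫ _ : Fin n → X × ℝ, l * ‖q.1‖ ^ 2 ∂(Measure.pi fun _ => P) :=
        integral_add (integrable_finsetSum _ fun i _ => hint i)
          (integrable_const _)
    _ = n * risk w P q.1 q.2 + l * ‖q.1‖ ^ 2 := by
        rw [integral_finsetSum _ fun i _ => hint i]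
        simp [hterm]

theorem integrable_pointLoss_estimator [NeZero n] (hw0 : 0 < w) (hw1 : w < 1) (hl : 0 < l)
    (hM : ∀ x, ‖K.feature x‖ ≤ M) (hK : Measurable fun z : X × X => K z.1 z.2)
    (hy : Integrable (fun z : X × ℝ => z.2 ^ 2) P) :
    Integrable (fun p : (X × ℝ) × (Fin n → X × ℝ) => pointLoss w (estimator w K l p.2) p.1)
      (P.prod (Measure.pi fun _ => P)) := by
  have hmeas := (JointlyMeasurable.estimator (n := n) hw0 hw1 hl hM hK).pointLoss (w := w)
  have hsplit := measurePreserving_piFinSuccAbove (fun _ : Fin (n + 1) => P) 0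
  have hbound : ∀ d : Fin (n + 1) → X × ℝ,
      ‖pointLoss w (estimator w K l (Fin.removeNth 0 d)) (d 0)‖ ≤
        (1 + stabilityConst w l M n) ^ 2 * objective w K l d 0 := fun d => by
    rw [Real.norm_of_nonneg (pointLoss_nonneg hw0 hw1 _ _)]
    refine (pointLoss_estimator_removeNth_le hw0 hw1 hl hM d 0).trans ?_
    gcongr
    exact (pointLoss_le_objective hw0 hw1 hl.le d _ 0).trans (isMinimizer_estimator hw0 hw1 hl d 0)
  refine (hsplit.integrable_comp_emb (MeasurableEquiv.measurableEmbedding _)).1 ?_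
  exact ((integrable_objective (integrable_pointLoss hw0 hw1 hM hK hy 0)).const_mul _).mono'
    (hmeas.comp hsplit.measurable).aestronglyMeasurable (ae_of_all _ hbound)

theorem integrable_observedRisk_pi [NeZero n] (hw0 : 0 < w) (hw1 : w < 1) (hl : 0 < l)
    (hM : ∀ x, ‖K.feature x‖ ≤ M) (hK : Measurable fun z : X × X => K z.1 z.2)
    (hy : Integrable (fun z : X × ℝ => z.2 ^ 2) P) :
    Integrable (fun d : Fin n → X × ℝ => observedRisk w P K l d) (Measure.pi fun _ => P) :=
  (integrable_pointLoss_estimator hw0 hw1 hl hM hK hy).integral_prod_right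

theorem integrable_pointLoss_estimator_removeNth [NeZero n] (hw0 : 0 < w) (hw1 : w < 1)
    (hl : 0 < l) (hM : ∀ x, ‖K.feature x‖ ≤ M) (hK : Measurable fun z : X × X => K z.1 z.2)
    (hy : Integrable (fun z : X × ℝ => z.2 ^ 2) P) (i : Fin (n + 1)) :
    Integrable (fun d : Fin (n + 1) → X × ℝ =>
      pointLoss w (estimator w K l (i.removeNth d)) (d i)) (Measure.pi fun _ => P) :=
  (measurePreserving_piFinSuccAbove (fun _ : Fin (n + 1) => P) i).integrable_comp_of_integrable
    (integrable_pointLoss_estimator hw0 hw1 hl hM hK hy)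

theorem integral_pointLoss_estimator_removeNth [NeZero n] (hw0 : 0 < w) (hw1 : w < 1) (hl : 0 < l)
    (hM : ∀ x, ‖K.feature x‖ ≤ M) (hK : Measurable fun z : X × X => K z.1 z.2)
    (hy : Integrable (fun z : X × ℝ => z.2 ^ 2) P) (i : Fin (n + 1)) :
    ∫ d : Fin (n + 1) → X × ℝ, pointLoss w (estimator w K l (i.removeNth d)) (d i)
        ∂(Measure.pi fun _ => P) =
      ∫ d : Fin n → X × ℝ, observedRisk w P K l d ∂(Measure.pi fun _ => P) :=
  ((measurePreserving_piFinSuccAbove (fun _ : Fin (n + 1) => P) i).integral_comp'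
    (fun p => pointLoss w (estimator w K l p.2) p.1)).trans
    (integral_prod_symm _ (integrable_pointLoss_estimator hw0 hw1 hl hM hK hy))

theorem integral_observedRisk_pi_le [NeZero n] (hw0 : 0 < w) (hw1 : w < 1) (hl : 0 < l)
    (hM : ∀ x, ‖K.feature x‖ ≤ M) (hK : Measurable fun z : X × X => K z.1 z.2)
    (hy : Integrable (fun z : X × ℝ => z.2 ^ 2) P) (q : K.Space × ℝ) :
    ∫ d : Fin n → X × ℝ, observedRisk w P K l d ∂(Measure.pi fun _ => P) ≤
      (1 + stabilityConst w l M n) ^ 2 * (risk w P q.1 q.2 + l / n * ‖q.1‖ ^ 2) := by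
  have hq := integrable_pointLoss hw0 hw1 hM hK hy q
  have hloo := fun i : Fin (n + 1) =>
    integrable_pointLoss_estimator_removeNth hw0 hw1 hl hM hK hy i
  have hsum : (n + 1) * ∫ d : Fin n → X × ℝ, observedRisk w P K l d ∂(Measure.pi fun _ => P) ≤
      (1 + stabilityConst w l M n) ^ 2 *
        ((n + 1) * risk w P q.1 q.2 + l * ‖q.1‖ ^ 2) :=
    calc (n + 1) * ∫ d : Fin n → X × ℝ, observedRisk w P K l d ∂(Measure.pi fun _ => P)
      _ = ∫ d : Fin (n + 1) → X × ℝ, ∑ i, pointLoss w (estimator w K l (i.removeNth d)) (d i)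
            ∂(Measure.pi fun _ => P) := by
          rw [integral_finsetSum _ fun i _ => hloo i]
          simp [integral_pointLoss_estimator_removeNth hw0 hw1 hl hM hK hy]
      _ ≤ ∫ d : Fin (n + 1) → X × ℝ, (1 + stabilityConst w l M n) ^ 2 * objective w K l d q
            ∂(Measure.pi fun _ => P) :=
          integral_mono (integrable_finsetSum _ fun i _ => hloo i)
            ((integrable_objective hq).const_mul _)
            fun d => sum_pointLoss_estimator_removeNth_le hw0 hw1 hl hM d q
      _ = _ := by rw [integral_const_mul, integral_objective hq, Nat.cast_succ]
  refine le_of_mul_le_mul_left (hsum.trans ?_) (by positivity : (0 : ℝ) < n + 1)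
  have hpen : l ≤ (n + 1) * (l / n) := by
    rw [add_one_mul, mul_div_cancel₀ l (NeZero.ne (n : ℝ))]
    exact le_add_of_nonneg_right (by positivity)
  calc (1 + stabilityConst w l M n) ^ 2 * ((n + 1) * risk w P q.1 q.2 + l * ‖q.1‖ ^ 2)
    _ ≤ (1 + stabilityConst w l M n) ^ 2 *
          ((n + 1) * risk w P q.1 q.2 + (n + 1) * (l / n) * ‖q.1‖ ^ 2) := by gcongr
    _ = _ := by ring

end LeaveOneOut

section Consistency

variable {X : Type*} [MeasurableSpace X] {K : PosDefKernel X} {w M : ℝ} {lam : ℕ → ℝ}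
  {P : Measure (X × ℝ)}

theorem tendsto_stabilityConst (hw0 : 0 < w) (hw1 : w < 1) (hlam : Tendsto lam atTop atTop) :
    Tendsto (fun n => stabilityConst w (lam n) M n) atTop (𝓝 0) := by
  have hc : 0 < min w (1 - w) := lt_min hw0 (sub_pos.2 hw1)
  simpa only [stabilityConst, add_zero] using
    (tendsto_const_nhds.div_atTop (tendsto_natCast_atTop_atTop.const_mul_atTop hc)).add
      (tendsto_const_nhds.div_atTop hlam)

theorem idealRisk_le (hw0 : 0 < w) (hw1 : w < 1) (q : K.Space × ℝ) :
    idealRisk w P K ≤ risk w P q.1 q.2 :=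
  ciInf_le ⟨0, by rintro _ ⟨p, rfl⟩; exact integral_nonneg fun _ => loss_nonneg hw0 hw1 _⟩ q

theorem eventually_one_le_and_pos (hlam : Tendsto lam atTop atTop) :
    ∀ᶠ n in atTop, 1 ≤ n ∧ 0 < lam n :=
  (eventually_ge_atTop 1).and (hlam.eventually_gt_atTop 0)

variable [IsProbabilityMeasure P]

theorem tendsto_integral_observedRisk_pi (hw0 : 0 < w) (hw1 : w < 1)
    (hM : ∀ x, ‖K.feature x‖ ≤ M) (hK : Measurable fun z : X × X => K z.1 z.2)
    (hy : Integrable (fun z : X × ℝ => z.2 ^ 2) P) (hlam : Tendsto lam atTop atTop)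
    (hlam_div : Tendsto (fun n : ℕ => lam n / n) atTop (𝓝 0)) :
    Tendsto (fun n : ℕ => ∫ d : Fin n → X × ℝ, observedRisk w P K (lam n) d
      ∂(Measure.pi fun _ => P)) atTop (𝓝 (idealRisk w P K)) := by
  refine tendsto_order.2 ⟨fun b hb => ?_, fun b hb => ?_⟩
  · filter_upwards [eventually_one_le_and_pos hlam] with n ⟨hn, hl⟩
    have : NeZero n := ⟨Nat.one_le_iff_ne_zero.1 hn⟩
    refine hb.trans_le ?_
    simpa using integral_mono (integrable_const _)
      (integrable_observedRisk_pi (n := n) hw0 hw1 hl hM hK hy) fun d => idealRisk_le hw0 hw1 _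
  · obtain ⟨q, hq⟩ := exists_lt_of_ciInf_lt hb
    have hbound : Tendsto (fun n : ℕ => (1 + stabilityConst w (lam n) M n) ^ 2 *
        (risk w P q.1 q.2 + lam n / n * ‖q.1‖ ^ 2)) atTop (𝓝 (risk w P q.1 q.2)) := by
      simpa using (((tendsto_stabilityConst hw0 hw1 hlam).const_add 1).pow 2).mul
        ((hlam_div.mul_const (‖q.1‖ ^ 2)).const_add (risk w P q.1 q.2))
    filter_upwards [eventually_one_le_and_pos hlam, hbound.eventually_lt_const hq]
      with n ⟨hn, hl⟩ hlt
    have : NeZero n := ⟨Nat.one_le_iff_ne_zero.1 hn⟩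
    exact (integral_observedRisk_pi_le hw0 hw1 hl hM hK hy q).trans_lt hlt

end Consistency

section Convergence

variable {Ω : Type*} [MeasurableSpace Ω] {μ : Measure Ω}

theorem hasLaw_pi_sample {S : Type*} [MeasurableSpace S] {P : Measure S}
    {Z : ℕ → Ω → S} (hlaw : ∀ i, HasLaw (Z i) P μ) (hindep : iIndepFun Z μ) (n : ℕ) :
    HasLaw (fun ω (i : Fin n) => Z i ω) (Measure.pi fun _ => P) μ :=
  (hindep.precomp Fin.val_injective).hasLaw_pi fun i => hlaw i

theorem tendstoInMeasure_of_tendsto_integral [IsProbabilityMeasure μ] {f : ℕ → Ω → ℝ} {a : ℝ}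
    (hf : ∀ᶠ n in atTop, Integrable (f n) μ) (hle : ∀ n ω, a ≤ f n ω)
    (hlim : Tendsto (fun n => ∫ ω, f n ω ∂μ) atTop (𝓝 a)) :
    TendstoInMeasure μ (fun n ω => f n ω - a) atTop fun _ => 0 := by
  rw [tendstoInMeasure_iff_measureReal_norm]
  intro ε hε
  have hbound : Tendsto (fun n => ε⁻¹ * (∫ ω, f n ω ∂μ - a)) atTop (𝓝 0) := by
    simpa using (hlim.sub_const a).const_mul ε⁻¹
  refine squeeze_zero' (Eventually.of_forall fun n => measureReal_nonneg) ?_ hbound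
  filter_upwards [hf] with n hn
  have hmarkov := mul_meas_ge_le_integral_of_nonneg
    (ae_of_all μ fun ω => sub_nonneg.2 (hle n ω)) (hn.sub (integrable_const a)) ε
  rw [integral_sub hn (integrable_const a), integral_const, probReal_univ, one_smul] at hmarkov
  rw [inv_mul_eq_div, le_div_iff₀' hε]
  simpa only [sub_zero, Real.norm_of_nonneg (sub_nonneg.2 (hle n _))] using hmarkov

theorem tendsto_atTop_of_tendsto_div_rpow {u : ℕ → ℝ} {s : ℝ} (hs : 0 < s)
    (hu : Tendsto (fun n : ℕ => u n / (n : ℝ) ^ s) atTop atTop) : Tendsto u atTop atTop := by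
  have hpow : Tendsto (fun n : ℕ => (n : ℝ) ^ s) atTop atTop :=
    (tendsto_rpow_atTop hs).comp tendsto_natCast_atTop_atTop
  refine (hu.atTop_mul_atTop₀ hpow).congr' ?_
  filter_upwards [hpow.eventually_gt_atTop 0] with n hn
  exact div_mul_cancel₀ _ hn.ne'

end Convergence

section Sample

variable {X : Type*} [MeasurableSpace X] {K : PosDefKernel X} {w M : ℝ}
  {P : Measure (X × ℝ)} [IsProbabilityMeasure P]
  {Ω : Type*} [MeasurableSpace Ω] {μ : Measure Ω} {Z : ℕ → Ω → X × ℝ}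

theorem integrable_observedRisk {n : ℕ} [NeZero n] {l : ℝ} (hlaw : ∀ i, HasLaw (Z i) P μ)
    (hindep : iIndepFun Z μ) (hw0 : 0 < w) (hw1 : w < 1) (hl : 0 < l)
    (hM : ∀ x, ‖K.feature x‖ ≤ M) (hK : Measurable fun z : X × X => K z.1 z.2)
    (hy : Integrable (fun z : X × ℝ => z.2 ^ 2) P) :
    Integrable (fun ω => observedRisk w P K l fun i : Fin n => Z i ω) μ := by
  have hZ := hasLaw_pi_sample hlaw hindep n
  have hint := integrable_observedRisk_pi (n := n) hw0 hw1 hl hM hK hy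
  rw [← hZ.map_eq] at hint
  exact hint.comp_aemeasurable hZ.aemeasurable

theorem tendsto_integral_observedRisk {lam : ℕ → ℝ} (hlaw : ∀ i, HasLaw (Z i) P μ)
    (hindep : iIndepFun Z μ) (hw0 : 0 < w) (hw1 : w < 1) (hM : ∀ x, ‖K.feature x‖ ≤ M)
    (hK : Measurable fun z : X × X => K z.1 z.2)
    (hy : Integrable (fun z : X × ℝ => z.2 ^ 2) P) (hlam : Tendsto lam atTop atTop)
    (hlam_div : Tendsto (fun n : ℕ => lam n / n) atTop (𝓝 0)) :
    Tendsto (fun n : ℕ => ∫ ω, observedRisk w P K (lam n) (fun i : Fin n => Z i ω) ∂μ) atTop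
      (𝓝 (idealRisk w P K)) := by
  refine (tendsto_integral_observedRisk_pi hw0 hw1 hM hK hy hlam hlam_div).congr' ?_
  filter_upwards [eventually_one_le_and_pos hlam] with n ⟨hn, hl⟩
  have : NeZero n := ⟨Nat.one_le_iff_ne_zero.1 hn⟩
  exact ((hasLaw_pi_sample hlaw hindep n).integral_comp
    (integrable_observedRisk_pi hw0 hw1 hl hM hK hy).aestronglyMeasurable).symm

end Sample

end Expectile

open Expectile in
theorem theorem1_general {X : Type*} [MeasurableSpace X] {Ω : Type*} [MeasurableSpace Ω]
    (μ : Measure Ω) [IsProbabilityMeasure μ] (P : Measure (X × ℝ)) [IsProbabilityMeasure P]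
    (Z : ℕ → Ω → X × ℝ) (hlaw : ∀ i, HasLaw (Z i) P μ) (hindep : iIndepFun Z μ)
    (hy : Integrable (fun z : X × ℝ => z.2 ^ 2) P)
    (K : PosDefKernel X) (hKmeas : Measurable (fun z : X × X => K z.1 z.2))
    (hM : BddAbove (Set.range fun x => (K x x) ^ (1 / 2 : ℝ)))
    (w : ℝ) (hw0 : 0 < w) (hw1 : w < 1) (lam : ℕ → ℝ) (hlam : Tendsto lam atTop atTop)
    (hlam_div : Tendsto (fun n : ℕ => lam n / (n : ℝ)) atTop (𝓝 0)) :
    (∀ (f : K.Space) (a : ℝ), Integrable (fun z => loss w (z.2 - a - f z.1)) P) ∧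
    (∀ n : ℕ, 1 ≤ n → 0 < lam n → ∀ d : Fin n → X × ℝ,
      ∃! q : K.Space × ℝ, IsMinimizer w K (lam n) d q) ∧
    (∀ n : ℕ, 1 ≤ n → 0 < lam n →
      Integrable (fun ω => observedRisk w P K (lam n) (fun i : Fin n => Z i ω)) μ) ∧
    Tendsto (fun n : ℕ => ∫ ω, observedRisk w P K (lam n) (fun i : Fin n => Z i ω) ∂μ)
      atTop (𝓝 (idealRisk w P K)) ∧
    TendstoInMeasure μ (fun (n : ℕ) (ω : Ω) =>
        observedRisk w P K (lam n) (fun i : Fin n => Z i ω) - idealRisk w P K)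
      atTop (fun _ => 0) := by
  obtain ⟨M, hM⟩ := hM
  have hfeature : ∀ x, ‖K.feature x‖ ≤ M := fun x => (norm_feature x).trans_le (hM ⟨x, rfl⟩)
  have hint : ∀ n : ℕ, 1 ≤ n → 0 < lam n →
      Integrable (fun ω => observedRisk w P K (lam n) (fun i : Fin n => Z i ω)) μ :=
    fun n hn hl =>
      have : NeZero n := ⟨Nat.one_le_iff_ne_zero.1 hn⟩
      integrable_observedRisk hlaw hindep hw0 hw1 hl hfeature hKmeas hy
  have hlim := tendsto_integral_observedRisk hlaw hindep hw0 hw1 hfeature hKmeas hy hlam hlam_div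
  refine ⟨fun f a => integrable_pointLoss hw0 hw1 hfeature hKmeas hy (f, a),
    fun n hn hl d => ?_, hint, hlim, ?_⟩
  · have : NeZero n := ⟨Nat.one_le_iff_ne_zero.1 hn⟩
    exact existsUnique_isMinimizer hw0 hw1 hl d
  · exact tendstoInMeasure_of_tendsto_integral
      ((eventually_one_le_and_pos hlam).mono fun n h => hint n h.1 h.2)
      (fun n ω => idealRisk_le hw0 hw1 _) hlim

theorem theorem1 {X : Type*} [MeasurableSpace X]
    {Ω : Type*} [MeasurableSpace Ω] (μ : Measure Ω) [IsProbabilityMeasure μ]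
    (P : Measure (X × ℝ)) [IsProbabilityMeasure P]
    -- the observations: independent, each with law `P`
    (Z : ℕ → Ω → X × ℝ) (hlaw : ∀ i, HasLaw (Z i) P μ) (hindep : iIndepFun Z μ)
    -- the response has a finite second moment
    (hy : Integrable (fun z : X × ℝ => z.2 ^ 2) P)
    -- the kernel is measurable, and `sup_x K(x,x)^{1/2}` is finite
    (K : Expectile.PosDefKernel X) (hKmeas : Measurable (fun z : X × X => K z.1 z.2))
    (hM : BddAbove (Set.range fun x => (K x x) ^ (1 / 2 : ℝ)))
    (w : ℝ) (hw0 : 0 < w) (hw1 : w < 1)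
    (lam : ℕ → ℝ)
    (hlam1 : Tendsto (fun n : ℕ => lam n / (n : ℝ) ^ (2 / 3 : ℝ)) atTop atTop)
    (hlam2 : Tendsto (fun n : ℕ => lam n / (n : ℝ)) atTop (𝓝 0)) :
    -- the risks are expectations of integrable random variables
    (∀ (f : K.Space) (a : ℝ), Integrable (fun z => Expectile.loss w (z.2 - a - f z.1)) P) ∧
    -- the estimator is well defined
    (∀ n : ℕ, 1 ≤ n → 0 < lam n → ∀ d : Fin n → X × ℝ,
      ∃! q : K.Space × ℝ, Expectile.IsMinimizer w K (lam n) d q) ∧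
    -- the observed risk is an integrable random variable
    (∀ n : ℕ, 1 ≤ n → 0 < lam n →
      Integrable (fun ω => Expectile.observedRisk w P K (lam n) (fun i : Fin n => Z i ω)) μ) ∧
    -- the expected observed risk converges to the ideal risk
    Tendsto
      (fun n : ℕ => ∫ ω, Expectile.observedRisk w P K (lam n) (fun i : Fin n => Z i ω) ∂μ)
      atTop (𝓝 (Expectile.idealRisk w P K)) ∧
    -- the observed risk converges to the ideal risk in probability
    TendstoInMeasure μ
      (fun (n : ℕ) (ω : Ω) =>
        Expectile.observedRisk w P K (lam n) (fun i : Fin n => Z i ω) - Expectile.idealRisk w P K)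
      atTop (fun _ => 0) := by
  exact theorem1_general μ P Z hlaw hindep hy K hKmeas hM w hw0 hw1 lam
    (Expectile.tendsto_atTop_of_tendsto_div_rpow (by norm_num) hlam1) hlam2
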